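/- For $n\ge 0$ let $H(n)$ be the $n$-dimensional hypercube: its vertex set is $\mathbb{Z}_2^n$, and two vertices are adjacent if they differ in exactly one coordinate. For $0\le i\le n$ let $U_i(n)$ be the eigenspace of its adjacency operator $f\mapsto\big(x\mapsto\sum_{y\sim x}f(y)\big)$, acting on functions $f:\mathbb{Z}_2^n\to\mathbb{R}$, for the eigenvalue $n-2i$. For $0\le i\le j\le n$ put $U_{[i,j]}(n)=U_i(n)\oplus U_{i+1}(n)\oplus\cdots\oplus U_j(n)$. Every function $f:\mathbb{Z}_2^n\to\mathbb{R}$ has a unique representation $f=\sum_{i=0}^n f_i$ with $f_i\in U_i(n)$; let $\mathrm{Spec}(f)=\{0\le i\le n: f_i\not\equiv 0\}$, and let $|f|$ be the number of vertices $x$ with $f(x)\ne 0$. A function $f\in U_{[i,j]}(n)$, $f\not\equiv0$, is called optimal in $U_{[i,j]}(n)$ if $|f|\le|g|$ for every $g\in U_{[i,j]}(n)$ with $g\not\equiv0$. Let $0\le i\le j\le n$. Then the following statements hold. (0) If $f$ is optimal in $U_{[i,j]}(n)$, then $\mathrm{Spec}(f)=\{a,a+d,\ldots,a+kd\}$ for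 some $d\in\{1,2\}$ and some non-negative integers $a,k$. (1) If $i+j\ge n$, $f\in U_{[i,j]}(n)$ and $|f|=2^i$, then $\mathrm{Spec}(f)=\{i,i+d,\ldots,i+kd\}$ for some $d\in\{1,2\}$ and some non-negative integer $k$ with $i+kd\le j$. (2) If $i+j\le n$, $f\in U_{[i,j]}(n)$ and $|f|=2^{n-j}$, then $\mathrm{Spec}(f)=\{j-kd,j-(k-1)d,\ldots,j\}$ for some $d\in\{1,2\}$ and some non-negative integer $k$ with $j-kd\ge i$. -/

import Mathlib

noncomputable section

namespace Hypercube

/-- The vertices of the `n`-dimensional hypercube: the vectors of `ℤ₂ⁿ`. -/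
abbrev Vertex (n : ℕ) : Type := Fin n → ZMod 2

/-- The `n`-dimensional hypercube: two vectors of `ℤ₂ⁿ` are adjacent if and only if they differ
in exactly one coordinate. -/
def graph (n : ℕ) : SimpleGraph (Vertex n) where
  Adj x y := hammingDist x y = 1
  symm := ⟨fun x y h => by rw [hammingDist_comm]; exact h⟩
  loopless := ⟨fun x h => by simp at h⟩

instance (n : ℕ) : DecidableRel (graph n).Adj :=
  fun x y => inferInstanceAs (Decidable (hammingDist x y = 1))

/-- The adjacency operator `f ↦ (x ↦ ∑ y ∈ N(x), f y)` on the space of real-valued functions. -/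
def adjOp (n : ℕ) : Module.End ℝ (Vertex n → ℝ) :=
  Matrix.toLin' ((graph n).adjMatrix ℝ)

/-- `U_i(n)`: the eigenspace of the hypercube for the eigenvalue `λ_i(n) = n - 2 i`. -/
def U (n i : ℕ) : Submodule ℝ (Vertex n → ℝ) :=
  Module.End.eigenspace (adjOp n) ((n : ℝ) - 2 * (i : ℝ))

/-- `U_{[i,j]}(n) = U_i(n) ⊕ U_{i+1}(n) ⊕ ⋯ ⊕ U_j(n)`. -/
def UInterval (n i j : ℕ) : Submodule ℝ (Vertex n → ℝ) :=
  ⨆ k ∈ Finset.Icc i j, U n k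

/-- `|f|`: the cardinality of the support of `f`. -/
def suppCard {n : ℕ} (f : Vertex n → ℝ) : ℕ :=
  (Function.support f).ncard

/-- `f` is optimal in `U_{[i,j]}(n)`: it lies there, is not identically zero, and its support has
the minimum cardinality among all functions of `U_{[i,j]}(n)` that are not identically zero. -/
def IsOptimal {n : ℕ} (i j : ℕ) (f : Vertex n → ℝ) : Prop :=
  f ∈ UInterval n i j ∧ f ≠ 0 ∧ ∀ g ∈ UInterval n i j, g ≠ 0 → suppCard f ≤ suppCard g

theorem mem_U_iff {n i : ℕ} {f : Vertex n → ℝ} :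
    f ∈ U n i ↔
      ∀ x, ((n : ℝ) - 2 * (i : ℝ)) * f x = ∑ y ∈ (graph n).neighborFinset x, f y := by
  unfold U adjOp
  rw [Module.End.mem_eigenspace_iff, funext_iff]
  refine forall_congr' fun x => ?_
  rw [Matrix.toLin'_apply, SimpleGraph.adjMatrix_mulVec_apply, Pi.smul_apply, smul_eq_mul]
  exact eq_comm

/-- The sign `(-1)^a` of an element `a` of `ℤ₂`. -/
def sgn (a : ZMod 2) : ℝ := if a = 0 then 1 else -1

theorem sgn_add_one (a : ZMod 2) : sgn (a + 1) = -sgn a := by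
  have h : a = 0 ∨ a = 1 := by revert a; decide
  have h11 : (1 + 1 : ZMod 2) = 0 := by decide
  rcases h with rfl | rfl <;> simp [sgn, h11]

theorem one_add_sgn_mul (a b : ZMod 2) : 1 + sgn a * sgn b = if a = b then 2 else 0 := by
  have h : ∀ c : ZMod 2, c = 0 ∨ c = 1 := by decide
  rcases h a with rfl | rfl <;> rcases h b with rfl | rfl <;> norm_num [sgn]

/-- The character `x ↦ ∏ k ∈ S, (-1)^{x k}`. -/
def chi {n : ℕ} (S : Finset (Fin n)) (x : Vertex n) : ℝ := ∏ k ∈ S, sgn (x k)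

theorem neighborFinset_eq {n : ℕ} (x : Vertex n) :
    (graph n).neighborFinset x =
      Finset.univ.image fun k : Fin n => Function.update x k (x k + 1) := by
  ext y
  simp only [SimpleGraph.mem_neighborFinset, Finset.mem_image, Finset.mem_univ, true_and]
  change hammingDist x y = 1 ↔ _
  unfold hammingDist
  rw [Finset.card_eq_one]
  constructor
  · rintro ⟨k, hk⟩
    refine ⟨k, ?_⟩
    have h2 : ∀ a b : ZMod 2, a ≠ b → a + 1 = b := by decide
    ext1 l
    have hl : x l ≠ y l ↔ l = k := by
      have := congrArg (fun s => l ∈ s) hk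
      simpa using this
    by_cases h : l = k
    · subst h
      simpa using h2 _ _ (hl.2 rfl)
    · rw [Function.update_of_ne h]
      by_contra hne
      exact h (hl.1 hne)
  · rintro ⟨k, rfl⟩
    refine ⟨k, ?_⟩
    ext l
    by_cases h : l = k
    · subst h
      simp
    · simp [h]

theorem chi_mem_U {n : ℕ} (S : Finset (Fin n)) : chi S ∈ U n S.card := by
  rw [mem_U_iff]
  intro x
  rw [neighborFinset_eq, Finset.sum_image]
  · have h : ∀ k : Fin n, chi S (Function.update x k (x k + 1)) =
        (1 - 2 * if k ∈ S then 1 else 0) * chi S x := by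
      intro k
      unfold chi
      by_cases hk : k ∈ S
      · rw [← Finset.mul_prod_erase S _ hk, ← Finset.mul_prod_erase S (fun k => sgn (x k)) hk,
          Function.update_self, sgn_add_one, if_pos hk]
        rw [Finset.prod_congr rfl (g := fun k => sgn (x k))]
        · ring
        · intro l hl
          rw [Function.update_of_ne (Finset.ne_of_mem_erase hl)]
      · rw [if_neg hk, Finset.prod_congr rfl (g := fun k => sgn (x k))]
        · ring
        · intro l hl
          rw [Function.update_of_ne (by rintro rfl; exact hk hl)]
    simp only [h]
    rw [← Finset.sum_mul, Finset.sum_sub_distrib, ← Finset.mul_sum]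
    simp
  · intro k _ l _ hkl
    by_contra hne
    have := congrFun hkl k
    simp [Function.update_of_ne hne] at this

theorem eq_sum_chi {n : ℕ} (f : Vertex n → ℝ) :
    f = ∑ S : Finset (Fin n), ((2 : ℝ) ^ n)⁻¹ • (∑ a, f a * chi S a) • chi S := by
  ext1 x
  have key : ∀ a : Vertex n, ∑ S : Finset (Fin n), chi S a * chi S x =
      if a = x then (2 : ℝ) ^ n else 0 := by
    intro a
    have h1 : ∏ k : Fin n, (1 + sgn (a k) * sgn (x k)) =
        ∑ S : Finset (Fin n), chi S a * chi S x := by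
      rw [Finset.prod_one_add, Finset.powerset_univ]
      exact Finset.sum_congr rfl fun S _ => Finset.prod_mul_distrib
    rw [← h1]
    simp only [one_add_sgn_mul]
    split_ifs with h
    · subst h
      simp
    · obtain ⟨k, hk⟩ := Function.ne_iff.1 h
      exact Finset.prod_eq_zero (Finset.mem_univ k) (by simp [hk])
  simp only [Finset.sum_apply, Pi.smul_apply, smul_eq_mul]
  rw [← Finset.mul_sum]
  simp only [Finset.sum_mul]
  rw [Finset.sum_comm]
  simp only [mul_assoc, ← Finset.mul_sum, key]
  simp [mul_comm (f x)]

/-- Every function has a unique representation `f = ∑ f_i` with `f_i ∈ U_i(n)`, `0 ≤ i ≤ n`. -/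
theorem existsUnique_decomposition {n : ℕ} (f : Vertex n → ℝ) :
    ∃! g : Fin (n + 1) → (Vertex n → ℝ), (∀ i : Fin (n + 1), g i ∈ U n i) ∧ f = ∑ i, g i := by
  refine existsUnique_of_exists_of_unique ?_ ?_
  · refine ⟨fun i => ∑ S : Finset (Fin n) with
      (⟨S.card, Nat.lt_succ_of_le (by simpa using S.card_le_univ)⟩ : Fin (n + 1)) = i,
      ((2 : ℝ) ^ n)⁻¹ • (∑ a, f a * chi S a) • chi S, fun i => ?_, ?_⟩
    · refine Submodule.sum_mem _ fun S hS => Submodule.smul_mem _ _ (Submodule.smul_mem _ _ ?_)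
      rw [Finset.mem_filter] at hS
      rw [← hS.2]
      exact chi_mem_U S
    · rw [Finset.sum_fiberwise]
      exact eq_sum_chi f
  · rintro g g' ⟨hg, hfg⟩ ⟨hg', hfg'⟩
    have hind : iSupIndep fun i : Fin (n + 1) => U n i :=
      (Module.End.eigenspaces_iSupIndep (adjOp n)).comp
        (f := fun i : Fin (n + 1) => (n : ℝ) - 2 * ((i : ℕ) : ℝ)) (by
          intro i j hij
          have : ((i : ℕ) : ℝ) = ((j : ℕ) : ℝ) := by
            simp only at hij
            linarith
          exact Fin.ext (by exact_mod_cast this))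
    rw [iSupIndep_iff_finsetSum_eq_imp_eq] at hind
    ext1 i
    exact hind Finset.univ g g' (fun i _ => ⟨hg i, hg' i⟩) (hfg.symm.trans hfg') i
      (Finset.mem_univ i)

/-- The component `f_i` in the unique representation `f = ∑ f_i` with `f_i ∈ U_i(n)`. -/
def component {n : ℕ} (f : Vertex n → ℝ) : Fin (n + 1) → (Vertex n → ℝ) :=
  (existsUnique_decomposition f).choose

/-- The spectrum of `f`: the set of all `0 ≤ i ≤ n` for which `f_i` is not identically zero. -/
def Spec {n : ℕ} (f : Vertex n → ℝ) : Set ℕ :=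
  {i | ∃ h : i < n + 1, component f ⟨i, h⟩ ≠ 0}

end Hypercube

end

/-! Membership of `f` in `UInterval n i j` means that its Fourier coefficients live on sets of size
between `i` and `j`. Vanishing below size `i` forces the sum of `f` over every subcube with fewer
than `i` fixed coordinates to be zero (`VanishesBelow`).

Induction on the dimension through the two slices along one coordinate gives at least `2 ^ i`
nonzero values (`VanishesBelow.two_pow_le`). Tracing equality (`VanishesBelow.exists_isBlockForm`)
shows that an extremal `f` is a signed indicator of an affine flat over `ℤ₂` with `i` directions
having disjoint supports, the blocks; coordinates outside the blocks are fixed.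

The Fourier coefficient of such a function at `T` is nonzero exactly when `T` meets every block in
an odd number of points. The sizes of these sets `T` start at `i` and run without gaps in steps of 1
if a fixed coordinate exists, and of 2 otherwise (`IsBlockForm.exists_spec_eq`).

For `i + j ≥ n` an explicit block function attains `2 ^ i`, so optimal functions have this support
size. Multiplication by the full character preserves supports and sends the spectrum `S` to `n - S`,
which transfers everything to `i + j ≤ n`. -/

namespace Hypercube

open Finset

/-! ### Slices along the first coordinate -/

/-- The restriction of `f` to the facet `x 0 = b`. -/
def slice {n : ℕ} (f : Vertex (n + 1) → ℝ) (b : ZMod 2) (x : Vertex n) : ℝ :=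
  f (Fin.cons b x : Fin (n + 1) → ZMod 2)

theorem zmod_two_cases (a : ZMod 2) : a = 0 ∨ a = 1 := by
  revert a; decide

theorem sum_zmod_two {M : Type*} [AddCommMonoid M] (F : ZMod 2 → M) :
    ∑ b, F b = F 0 + F 1 :=
  Fin.sum_univ_two F

theorem sum_vertex_succ {M : Type*} [AddCommMonoid M] {n : ℕ} (F : Vertex (n + 1) → M) :
    ∑ x, F x = ∑ b : ZMod 2, ∑ x : Vertex n, F (Fin.cons b x : Fin (n + 1) → ZMod 2) := by
  rw [← Fintype.sum_prod_type']
  exact (Equiv.sum_comp (Fin.consEquiv fun _ : Fin (n + 1) => ZMod 2) F).symm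

theorem suppCard_eq_sum {n : ℕ} (f : Vertex n → ℝ) :
    suppCard f = ∑ x, if f x ≠ 0 then 1 else 0 := by
  classical
  rw [suppCard, ← Finset.card_filter, ← Set.ncard_coe_finset]
  congr 1
  ext x
  simp

theorem suppCard_eq_slice {n : ℕ} (f : Vertex (n + 1) → ℝ) :
    suppCard f = suppCard (slice f 0) + suppCard (slice f 1) := by
  simp only [suppCard_eq_sum, sum_vertex_succ, sum_zmod_two]
  rfl

theorem suppCard_eq_zero {n : ℕ} {f : Vertex n → ℝ} : suppCard f = 0 ↔ f = 0 := by
  rw [suppCard, Set.ncard_eq_zero (Set.toFinite _), Function.support_eq_empty_iff]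

theorem suppCard_add_le {n : ℕ} (f g : Vertex n → ℝ) :
    suppCard (f + g) ≤ suppCard f + suppCard g :=
  (Set.ncard_le_ncard (Function.support_add f g) (Set.toFinite _)).trans
    (Set.ncard_union_le _ _)

theorem disjoint_of_suppCard_add {n : ℕ} {f g : Vertex n → ℝ}
    (h : suppCard f + suppCard g ≤ suppCard (f + g)) (x : Vertex n) : f x = 0 ∨ g x = 0 := by
  by_contra! hx
  have h1 := Set.ncard_union_add_ncard_inter (Function.support f) (Function.support g)
  have h2 : 0 < (Function.support f ∩ Function.support g).ncard :=
    (Set.ncard_pos (Set.toFinite _)).2 ⟨x, hx⟩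
  have h3 := Set.ncard_le_ncard (Function.support_add f g) (Set.toFinite _)
  unfold suppCard at h
  change (Function.support (f + g)).ncard ≤ _ at h3
  omega

theorem eq_zero_of_slice {n : ℕ} {f : Vertex (n + 1) → ℝ} (h : ∀ b, slice f b = 0) : f = 0 := by
  ext x
  rw [← Fin.cons_self_tail x]
  exact congrFun (h (x 0)) (Fin.tail x)

/-! ### Functions whose sums over subcubes of small codimension vanish -/

/-- The sum of `f` over every subcube obtained by fixing fewer than `r` coordinates vanishes. -/
def VanishesBelow {n : ℕ} (r : ℕ) (f : Vertex n → ℝ) : Prop :=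
  ∀ K : Finset (Fin n), K.card < r → ∀ a : Vertex n,
    (∑ x, if ∀ k ∈ K, x k = a k then f x else 0) = 0

/-- A subcube of a facet becomes a subcube of the whole cube by fixing one further coordinate, hence
the loss of one in `r`. -/
theorem VanishesBelow.slice {n r : ℕ} {f : Vertex (n + 1) → ℝ} (hf : VanishesBelow (r + 1) f)
    (b : ZMod 2) : VanishesBelow r (slice f b) := by
  intro K hK a
  have h := hf (insert 0 (K.map (Fin.succEmb n)))
    (lt_of_le_of_lt (card_insert_le _ _) (by simpa using hK)) (Fin.cons b a : Fin (n + 1) → ZMod 2)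
  rw [sum_vertex_succ, sum_eq_single b] at h
  · simpa [Hypercube.slice] using h
  · intro b' _ hb'
    exact sum_eq_zero fun x _ => if_neg fun hx => hb' (by simpa using hx 0 (mem_insert_self _ _))
  · simp

/-- Here coordinate 0 stays free, so nothing is lost in `r`. -/
theorem VanishesBelow.slice_add {n r : ℕ} {f : Vertex (n + 1) → ℝ} (hf : VanishesBelow r f) :
    VanishesBelow r (Hypercube.slice f 0 + Hypercube.slice f 1) := by
  intro K hK a
  have h := hf (K.map (Fin.succEmb n)) (by simpa using hK) (Fin.cons 0 a : Fin (n + 1) → ZMod 2)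
  rw [sum_vertex_succ, sum_zmod_two, ← sum_add_distrib] at h
  refine (sum_congr rfl fun x _ => ?_).trans h
  simp only [mem_map, forall_exists_index, and_imp, forall_apply_eq_imp_iff₂, Fin.coe_succEmb,
    Fin.cons_succ, Pi.add_apply, Hypercube.slice]
  split_ifs <;> simp

/-- A nonzero function whose sums over subcubes of codimension less than `r` vanish has at
least `2 ^ r` nonzero values. -/
theorem VanishesBelow.two_pow_le {n r : ℕ} {f : Vertex n → ℝ} (hf : VanishesBelow r f)
    (h0 : f ≠ 0) : 2 ^ r ≤ suppCard f := by
  induction n generalizing r with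
  | zero =>
    rcases r with - | r
    · exact Nat.one_le_iff_ne_zero.2 fun h => h0 (suppCard_eq_zero.1 h)
    · exfalso
      apply h0
      ext x
      have h := hf ∅ (by simp) x
      rw [Fintype.sum_unique, if_pos (by simp)] at h
      exact (congrArg f (Subsingleton.elim _ _)).trans h
  | succ n ih =>
    rw [suppCard_eq_slice]
    -- If the slices cancel, they have equal supports, each bounded below with `r - 1`; otherwise
    -- their sum already satisfies the bound for `r`.
    by_cases hs : Hypercube.slice f 0 + Hypercube.slice f 1 = 0
    · have h1 : Hypercube.slice f 1 = -Hypercube.slice f 0 := (neg_eq_of_add_eq_zero_right hs).symm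
      have hz : Hypercube.slice f 0 ≠ 0 := fun h => h0 <| eq_zero_of_slice fun b => by
        rcases zmod_two_cases b with rfl | rfl
        · exact h
        · rw [h1, h, neg_zero]
      have h2 : suppCard (Hypercube.slice f 1) = suppCard (Hypercube.slice f 0) := by
        rw [h1, suppCard, suppCard]
        congr 1
        ext x
        simp
      rcases r with - | r
      · have := suppCard_eq_zero.not.2 hz
        simp; omega
      · have := ih (hf.slice 0) hz
        rw [h2, pow_succ]; omega
    · exact (ih hf.slice_add hs).trans (suppCard_add_le _ _)

end Hypercube

namespace Hypercube

open Finset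

/-! ### Signed indicators of affine flats with disjoint directions -/

theorem sgn_mul_self (a : ZMod 2) : sgn a * sgn a = 1 := by
  rcases zmod_two_cases a with rfl | rfl <;> norm_num [sgn]

theorem sgn_ne_zero (a : ZMod 2) : sgn a ≠ 0 := fun h => by
  simpa [h] using sgn_mul_self a

theorem sgn_add (a b : ZMod 2) : sgn (a + b) = sgn a * sgn b := by
  rcases zmod_two_cases b with rfl | rfl
  · simp [sgn]
  · rw [sgn_add_one]; simp [sgn]

/-- The affine embedding with origin `a` whose directions are the blocks `p ⁻¹' {some s}`;
coordinates in `p ⁻¹' {none}` are fixed. -/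
def blockEmb {n : ℕ} {ι : Type} (p : Fin n → Option ι) (a : Vertex n) (z : ι → ZMod 2) :
    Vertex n := fun t => a t + (p t).elim 0 z

theorem blockEmb_apply {n : ℕ} {ι : Type} {p : Fin n → Option ι} (a : Vertex n)
    (z : ι → ZMod 2) {t : Fin n} {s : ι} (h : p t = some s) : blockEmb p a z t = a t + z s := by
  simp [blockEmb, h]

theorem blockEmb_injective {n : ℕ} {ι : Type} {p : Fin n → Option ι}
    (hp : ∀ s, ∃ t, p t = some s) (a : Vertex n) : Function.Injective (blockEmb p a) := by
  intro z w h
  ext1 s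
  obtain ⟨t, ht⟩ := hp s
  have := congrFun h t
  rwa [blockEmb_apply a z ht, blockEmb_apply a w ht, add_right_inj] at this

theorem blockEmb_cons {n : ℕ} {ι : Type} (o : Option ι) (p : Fin n → Option ι) (b : ZMod 2)
    (a : Vertex n) (z : ι → ZMod 2) :
    blockEmb (Fin.cons o p : Fin (n + 1) → Option ι) (Fin.cons b a : Fin (n + 1) → ZMod 2) z =
      (Fin.cons (b + o.elim 0 z) (blockEmb p a z) : Fin (n + 1) → ZMod 2) := by
  ext1 t
  refine Fin.cases ?_ (fun t => ?_) t <;> simp [blockEmb]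

/-- `f` is, up to a nonzero factor and a translation, the product over the blocks of `p` of the
functions `δ_0 - δ_1` on the diagonal of the block, times a delta function on the fixed
coordinates. -/
def IsBlockForm {n : ℕ} {ι : Type} [Fintype ι] (p : Fin n → Option ι) (f : Vertex n → ℝ) :
    Prop :=
  (∀ s, ∃ t, p t = some s) ∧ ∃ (a : Vertex n) (c : ℝ), c ≠ 0 ∧
    (∀ z, f (blockEmb p a z) = c * ∏ s, sgn (z s)) ∧ ∀ x, f x ≠ 0 → ∃ z, blockEmb p a z = x

/-- Coordinate 0 is constant on the support and becomes a fixed coordinate. -/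
theorem isBlockForm_cons_none {n : ℕ} {ι : Type} [Fintype ι] {p : Fin n → Option ι}
    {f : Vertex (n + 1) → ℝ} {b : ZMod 2} (h : IsBlockForm p (slice f b))
    (hb : ∀ b', b' ≠ b → slice f b' = 0) :
    IsBlockForm (Fin.cons none p : Fin (n + 1) → Option ι) f := by
  obtain ⟨hp, a, c, hc, hv, hs⟩ := h
  refine ⟨fun s => ?_, (Fin.cons b a : Fin (n + 1) → ZMod 2), c, hc, fun z => ?_, fun x hx => ?_⟩
  · obtain ⟨t, ht⟩ := hp s
    exact ⟨t.succ, by simpa using ht⟩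
  · rw [blockEmb_cons, ← hv]
    simp [slice]
  · rw [← Fin.cons_self_tail x] at hx ⊢
    have h0 : x 0 = b := by
      by_contra h0
      exact hx (congrFun (hb _ h0) (Fin.tail x))
    rw [h0] at hx ⊢
    obtain ⟨z, hz⟩ := hs _ hx
    refine ⟨z, ?_⟩
    rw [blockEmb_cons, hz]
    simp

/-- Coordinate 0 splits off as a factor `sgn`, that is, as a new one-element block. -/
theorem isBlockForm_cons_new {n : ℕ} {ι : Type} [Fintype ι] {p : Fin n → Option ι}
    {f : Vertex (n + 1) → ℝ} (h : IsBlockForm p (slice f 0))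
    (hf : slice f 1 = -slice f 0) :
    IsBlockForm (Fin.cons (some none) (fun t => (p t).map some) : Fin (n + 1) → Option (Option ι))
      f := by
  have hslice : ∀ b x, slice f b x = sgn b * slice f 0 x := fun b x => by
    rcases zmod_two_cases b with rfl | rfl
    · simp [sgn]
    · simp [hf, sgn]
  obtain ⟨hp, a, c, hc, hv, hs⟩ := h
  have hemb : ∀ z : Option ι → ZMod 2, blockEmb (fun t => (p t).map some) a z =
      blockEmb p a (fun s => z (some s)) := fun z => by
    ext1 t
    simp only [blockEmb]
    cases p t <;> simp
  refine ⟨fun s => ?_, (Fin.cons 0 a : Fin (n + 1) → ZMod 2), c, hc, fun z => ?_, fun x hx => ?_⟩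
  · rcases s with - | s
    · exact ⟨0, by simp⟩
    · obtain ⟨t, ht⟩ := hp s
      exact ⟨t.succ, by simp [ht]⟩
  · rw [blockEmb_cons, hemb, Fintype.prod_option]
    have := hslice (z none) (blockEmb p a fun s => z (some s))
    rw [hv] at this
    rw [mul_left_comm, ← this]
    simp [slice]
  · rw [← Fin.cons_self_tail x] at hx ⊢
    have hx' : slice f 0 (Fin.tail x) ≠ 0 := fun h0 => hx <| by
      have := hslice (x 0) (Fin.tail x)
      rwa [h0, mul_zero] at this
    obtain ⟨z, hz⟩ := hs _ hx'
    refine ⟨fun o => o.elim (x 0) z, ?_⟩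
    rw [blockEmb_cons, hemb]
    simp [hz]

/-- A function on a product that does not change under updates of one coordinate is constant. -/
theorem eq_of_forall_update_eq {ι α β : Type*} [Fintype ι] [DecidableEq ι] {F : (ι → α) → β}
    (h : ∀ z s b, F (Function.update z s b) = F z) (z w : ι → α) : F z = F w := by
  have key : ∀ I : Finset ι, F (I.piecewise w z) = F z := fun I => by
    induction I using Finset.induction_on with
    | empty => simp
    | insert s I _ ih => rw [Finset.piecewise_insert, h, ih]
  rw [← key univ, Finset.piecewise_univ]

theorem prod_sgn_update {ι : Type*} [Fintype ι] [DecidableEq ι] (z : ι → ZMod 2) (s : ι)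
    (b : ZMod 2) :
    ∏ u, sgn (Function.update z s b u) = sgn b * (sgn (z s) * ∏ u, sgn (z u)) := by
  rw [← mul_prod_erase univ _ (mem_univ s), ← mul_prod_erase univ (fun u => sgn (z u)) (mem_univ s),
    ← mul_assoc (sgn (z s)), sgn_mul_self, one_mul, Function.update_self]
  congr 1
  exact prod_congr rfl fun u hu => by rw [Function.update_of_ne (ne_of_mem_erase hu)]

/-- A restriction of `z ↦ ∏ sgn (z s)` whose sums over two-dimensional faces vanish is supported
on a facet, unless it is trivial. -/
theorem exists_support_eq_facet {ι : Type*} [Fintype ι] [DecidableEq ι]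
    {G : (ι → ZMod 2) → ℝ} {c : ℝ}
    (hc : c ≠ 0) (hG : ∀ z, G z = 0 ∨ G z = c * ∏ s, sgn (z s)) (h0 : ∃ z, G z = 0)
    (h1 : ∃ z, G z ≠ 0)
    (hsum : ∀ s t, s ≠ t → ∀ z : ι → ZMod 2,
      ∑ q : ZMod 2 × ZMod 2, G (Function.update (Function.update z s q.1) t q.2) = 0) :
    ∃ s b, ∀ z, G z ≠ 0 ↔ z s = b := by
  set P : (ι → ZMod 2) → ℝ := fun z => ∏ s, sgn (z s) with hP
  have hPP : ∀ z, P z * P z = 1 := fun z => by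
    simp only [hP]
    rw [← prod_mul_distrib]
    exact prod_eq_one fun s _ => sgn_mul_self _
  have hP0 : ∀ z, P z ≠ 0 := fun z h => by simpa [h] using hPP z
  -- Dividing out the sign leaves `c` times an indicator. Vanishing face sums of `G` become
  -- vanishing mixed second differences of `A`.
  set A : (ι → ZMod 2) → ℝ := fun z => G z * P z with hA
  have hA01 : ∀ z, A z = 0 ∨ A z = c := fun z => by
    rcases hG z with h | h
    · left; simp [hA, h]
    · right
      simp only [hA, h]
      rw [mul_assoc, hPP, mul_one]
  have hAG : ∀ z, G z = 0 ↔ A z = 0 := fun z => by simp [hA, hP0 z]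
  have hGA : ∀ z, G z = A z * P z := fun z => by
    simp only [hA]
    rw [mul_assoc, hPP, mul_one]
  have hdiff : ∀ s t, s ≠ t → ∀ z : ι → ZMod 2,
      A (Function.update (Function.update z s 0) t 0) -
        A (Function.update (Function.update z s 1) t 0) =
      A (Function.update (Function.update z s 0) t 1) -
        A (Function.update (Function.update z s 1) t 1) := by
    intro s t hst z
    have h := hsum s t hst z
    rw [Fintype.sum_prod_type, sum_zmod_two, sum_zmod_two, sum_zmod_two] at h
    simp only [hGA, hP, prod_sgn_update, Function.update_of_ne hst.symm] at h
    have hk : sgn (z t) * (sgn (z s) * P z) ≠ 0 :=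
      mul_ne_zero (sgn_ne_zero _) (mul_ne_zero (sgn_ne_zero _) (hP0 z))
    have e0 : sgn 0 = 1 := by simp [sgn]
    have e1 : sgn 1 = -1 := by simp [sgn]
    rw [e0, e1] at h
    apply mul_right_cancel₀ hk
    simp only [hP]
    linear_combination h
  -- The jump of `A` in direction `s` is therefore the same everywhere. Since `A` takes only the
  -- values `0` and `c`, one nonzero jump forces `A` to be `0` on one facet and `c` on the opposite
  -- one.
  have hconst : ∀ s (z w : ι → ZMod 2),
      A (Function.update z s 0) - A (Function.update z s 1) =
        A (Function.update w s 0) - A (Function.update w s 1) := by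
    intro s
    refine eq_of_forall_update_eq
      (F := fun z => A (Function.update z s 0) - A (Function.update z s 1)) fun z t b => ?_
    by_cases hst : s = t
    · subst hst; simp
    · have h2 : ∀ b, A (Function.update (Function.update z t b) s 0) -
          A (Function.update (Function.update z t b) s 1) =
          A (Function.update (Function.update z t 0) s 0) -
          A (Function.update (Function.update z t 0) s 1) := fun b => by
        rcases zmod_two_cases b with rfl | rfl
        · rfl
        · simp only [Function.update_comm (Ne.symm hst)]
          exact (hdiff s t hst z).symm
      rw [h2, ← h2 (z t), Function.update_eq_self]
  obtain ⟨s, z, b, hne⟩ : ∃ s z b, A (Function.update z s b) ≠ A z := by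
    by_contra! h
    obtain ⟨z, hz⟩ := h0
    obtain ⟨w, hw⟩ := h1
    rw [hAG] at hz
    rw [ne_eq, hAG] at hw
    exact hw ((eq_of_forall_update_eq (fun z s b => h s z b) w z).trans hz)
  have hne' : A (Function.update z s 0) - A (Function.update z s 1) ≠ 0 := fun h => hne <| by
    have h3 : ∀ b, A (Function.update z s b) = A (Function.update z s 0) := fun b => by
      rcases zmod_two_cases b with rfl | rfl
      · rfl
      · linarith
    rw [h3, ← h3 (z s), Function.update_eq_self]
  rcases hA01 (Function.update z s 0) with ha | ha <;>
    rcases hA01 (Function.update z s 1) with hb | hb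
  · simp [ha, hb] at hne'
  · refine ⟨s, 1, fun w => ?_⟩
    rw [ne_eq, hAG, ← Function.update_eq_self s w]
    have h := hconst s w z
    rw [ha, hb] at h
    have hw0 : A (Function.update w s 0) = 0 := (hA01 _).resolve_right fun h' => by
      rcases hA01 (Function.update w s 1) with h'' | h'' <;> rw [h', h''] at h <;>
        exact hc (by linarith)
    have hw1 : A (Function.update w s 1) = c := by linarith
    rcases zmod_two_cases (w s) with hws | hws <;> rw [hws] <;> simp [hw0, hw1, hc]
  · refine ⟨s, 0, fun w => ?_⟩
    rw [ne_eq, hAG, ← Function.update_eq_self s w]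
    have h := hconst s w z
    rw [ha, hb] at h
    have hw1 : A (Function.update w s 1) = 0 := (hA01 _).resolve_right fun h' => by
      rcases hA01 (Function.update w s 0) with h'' | h'' <;> rw [h', h''] at h <;>
        exact hc (by linarith)
    have hw0 : A (Function.update w s 0) = c := by linarith
    rcases zmod_two_cases (w s) with hws | hws <;> rw [hws] <;> simp [hw0, hw1, hc]
  · simp [ha, hb] at hne'

/-- If the two slices of `f` have disjoint supports, satisfy the vanishing condition, and their
sum is in block form, then so is `f`: the new coordinate joins one of the blocks. -/
theorem exists_isBlockForm_cons {n : ℕ} {ι : Type} [Fintype ι] [DecidableEq ι]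
    {p : Fin n → Option ι} {f : Vertex (n + 1) → ℝ}
    (h : IsBlockForm p (slice f 0 + slice f 1))
    (hdisj : ∀ x, slice f 0 x = 0 ∨ slice f 1 x = 0)
    (hf : VanishesBelow (Fintype.card ι - 1) (slice f 0)) (h0 : slice f 0 ≠ 0)
    (h1 : slice f 1 ≠ 0) :
    ∃ s, IsBlockForm (Fin.cons (some s) p : Fin (n + 1) → Option ι) f := by
  obtain ⟨hp, a, c, hc, hv, hs⟩ := h
  have hinj := blockEmb_injective hp a
  have hsum0 : ∀ x, slice f 0 x ≠ 0 → (slice f 0 + slice f 1) x = slice f 0 x := fun x hx => by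
    rw [Pi.add_apply, (hdisj x).resolve_left hx, add_zero]
  have hsum1 : ∀ x, slice f 1 x ≠ 0 → (slice f 0 + slice f 1) x = slice f 1 x := fun x hx => by
    rw [Pi.add_apply, (hdisj x).resolve_right hx, zero_add]
  have hs0 : ∀ x, slice f 0 x ≠ 0 → ∃ z, blockEmb p a z = x := fun x hx =>
    hs x (by rwa [hsum0 x hx])
  have hs1 : ∀ x, slice f 1 x ≠ 0 → ∃ z, blockEmb p a z = x := fun x hx =>
    hs x (by rwa [hsum1 x hx])
  obtain ⟨s, b, hsb⟩ : ∃ s b, ∀ z, slice f 0 (blockEmb p a z) ≠ 0 ↔ z s = b := by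
    refine exists_support_eq_facet (G := fun z => slice f 0 (blockEmb p a z)) hc
      (fun z => ?_) ?_ ?_ ?_
    · by_cases hz : slice f 0 (blockEmb p a z) = 0
      · exact Or.inl hz
      · right
        rw [← hv, hsum0 _ hz]
    · obtain ⟨x, hx⟩ := Function.ne_iff.1 h1
      obtain ⟨z, rfl⟩ := hs1 x hx
      exact ⟨z, (hdisj _).resolve_right hx⟩
    · obtain ⟨x, hx⟩ := Function.ne_iff.1 h0
      obtain ⟨z, rfl⟩ := hs0 x hx
      exact ⟨z, hx⟩
    · intro s t hst z
      -- Fixing one representative coordinate in each block other than `s` and `t` uses at most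
      -- `card ι - 2` coordinates. On the flat this leaves exactly the two-dimensional face in
      -- directions `s`, `t`.
      choose rep hrep using hp
      have hcard : #(image rep (univ \ {s, t})) < Fintype.card ι - 1 := by
        refine lt_of_le_of_lt card_image_le ?_
        have h2 := card_le_univ ({s, t} : Finset ι)
        rw [card_sdiff_of_subset (subset_univ _)]
        rw [card_pair hst] at h2 ⊢
        rw [card_univ]
        omega
      rw [← hf _ hcard (blockEmb p a z)]
      refine Fintype.sum_of_injective
        (fun q : ZMod 2 × ZMod 2 =>
          blockEmb p a (Function.update (Function.update z s q.1) t q.2)) ?_ _ _ ?_ ?_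
      · rintro ⟨α, β⟩ ⟨α', β'⟩ hq
        have hq := hinj hq
        have e1 := congrFun hq t
        have e2 := congrFun hq s
        simp only [Function.update_self, Function.update_of_ne hst] at e1 e2
        rw [e1, e2]
      · intro x hx
        rw [ite_eq_right_iff]
        intro hK
        by_contra hx0
        obtain ⟨w, rfl⟩ := hs0 x hx0
        refine hx ⟨(w s, w t), ?_⟩
        simp only
        congr 1
        ext1 u
        by_cases hut : u = t
        · subst hut; simp
        rw [Function.update_of_ne hut]
        by_cases hus : u = s
        · subst hus; simp
        rw [Function.update_of_ne hus]
        have := hK (rep u) (mem_image_of_mem _ (by simp [hut, hus]))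
        rw [blockEmb_apply a _ (hrep u), blockEmb_apply a _ (hrep u), add_right_inj] at this
        exact this.symm
      · rintro ⟨α, β⟩
        rw [if_pos]
        intro k hk
        obtain ⟨u, hu, rfl⟩ := mem_image.1 hk
        simp only [mem_sdiff, mem_univ, true_and, mem_insert, mem_singleton, not_or] at hu
        rw [blockEmb_apply a _ (hrep u), blockEmb_apply a _ (hrep u),
          Function.update_of_ne hu.2, Function.update_of_ne hu.1]
  have hb : ∀ u v : ZMod 2, u ≠ v → v + u = 1 := by decide
  -- On the flat, slice 0 is nonzero exactly where `z s = b`, so the nonzero value lies in slice `b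
  -- + z s`: coordinate 0 moves along with block `s`.
  have hval : ∀ z, slice f (b + z s) (blockEmb p a z) = c * ∏ s, sgn (z s) := fun z => by
    rw [← hv]
    by_cases hz : z s = b
    · rw [hz, CharTwo.add_self_eq_zero, hsum0 _ ((hsb z).2 hz)]
    · have e : b + z s = 1 := hb _ _ hz
      have hz' : slice f 0 (blockEmb p a z) = 0 := not_not.1 ((hsb z).not.2 hz)
      rw [e, Pi.add_apply, hz', zero_add]
  refine ⟨s, fun u => ?_, (Fin.cons b a : Fin (n + 1) → ZMod 2), c, hc, fun z => ?_,
    fun x hx => ?_⟩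
  · obtain ⟨t, ht⟩ := hp u
    exact ⟨t.succ, by simpa using ht⟩
  · rw [blockEmb_cons, ← hval]
    rfl
  · rw [← Fin.cons_self_tail x] at hx ⊢
    have hx' : slice f (x 0) (Fin.tail x) ≠ 0 := hx
    rcases zmod_two_cases (x 0) with e | e <;> rw [e] at hx' ⊢
    · obtain ⟨z, hz⟩ := hs0 _ hx'
      refine ⟨z, ?_⟩
      rw [← hz, hsb] at hx'
      rw [blockEmb_cons, hz]
      simp [hx', CharTwo.add_self_eq_zero]
    · obtain ⟨z, hz⟩ := hs1 _ hx'
      refine ⟨z, ?_⟩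
      have h2 := (hdisj _).resolve_right hx'
      rw [← hz, ← not_ne_iff, hsb] at h2
      rw [blockEmb_cons, hz]
      simp [hb _ _ h2]

/-- Functions attaining the bound `VanishesBelow.two_pow_le` are in block form. -/
theorem VanishesBelow.exists_isBlockForm {n r : ℕ} {f : Vertex n → ℝ} (hf : VanishesBelow r f)
    (hr : suppCard f = 2 ^ r) :
    ∃ (ι : Type) (_ : Fintype ι) (p : Fin n → Option ι),
      Fintype.card ι = r ∧ IsBlockForm p f := by
  induction n generalizing r with
  | zero =>
    have h1 : suppCard f ≤ 1 := by
      rw [suppCard_eq_sum, Fintype.sum_unique]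
      split_ifs <;> simp
    have hr0 : r = 0 := by
      by_contra h
      have := Nat.one_lt_two_pow h
      omega
    subst hr0
    refine ⟨PEmpty, inferInstance, fun _ => none, rfl, fun s => s.elim, default, f default,
      fun h => ?_, fun z => ?_, fun x _ => ⟨fun s => s.elim, Subsingleton.elim _ _⟩⟩
    · have : f = 0 := by
        ext x
        rw [Subsingleton.elim x default, h]
        rfl
      rw [suppCard_eq_zero.2 this] at hr
      simp at hr
    · rw [Subsingleton.elim (blockEmb _ _ z) default]
      simp
  | succ n ih =>
    rw [suppCard_eq_slice] at hr
    have hpos : 0 < 2 ^ r := by positivity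
    -- When one slice vanishes, the other equals the sum of both, so it satisfies the condition with
    -- the same `r`.
    by_cases h1 : Hypercube.slice f 1 = 0
    · have hadd := hf.slice_add
      rw [h1, add_zero] at hadd
      rw [h1, suppCard_eq_zero.2 rfl, add_zero] at hr
      obtain ⟨ι, _, p, hι, hp⟩ := ih hadd hr
      refine ⟨ι, _, _, hι, isBlockForm_cons_none hp fun b hb => ?_⟩
      rwa [(zmod_two_cases b).resolve_left hb]
    by_cases h0 : Hypercube.slice f 0 = 0
    · have hadd := hf.slice_add
      rw [h0, zero_add] at hadd
      rw [h0, suppCard_eq_zero.2 rfl, zero_add] at hr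
      obtain ⟨ι, _, p, hι, hp⟩ := ih hadd hr
      refine ⟨ι, _, _, hι, isBlockForm_cons_none hp fun b hb => ?_⟩
      rwa [(zmod_two_cases b).resolve_right hb]
    have hc0 := Nat.pos_of_ne_zero (suppCard_eq_zero.not.2 h0)
    have hc1 := Nat.pos_of_ne_zero (suppCard_eq_zero.not.2 h1)
    rcases r with - | r
    · simp at hr
      omega
    have hl0 := (hf.slice 0).two_pow_le h0
    have hl1 := (hf.slice 1).two_pow_le h1
    rw [pow_succ] at hr
    -- Cancelling slices each attain the bound for the smaller exponent. Otherwise the sum of the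
    -- slices attains the bound for the original exponent, which leaves no room for overlapping
    -- supports.
    by_cases hs : Hypercube.slice f 0 + Hypercube.slice f 1 = 0
    · obtain ⟨ι, _, p, hι, hp⟩ := ih (hf.slice 0) (by omega)
      exact ⟨Option ι, inferInstance, _, by simp [hι],
        isBlockForm_cons_new hp (neg_eq_of_add_eq_zero_right hs).symm⟩
    · have hl := hf.slice_add.two_pow_le hs
      have hle := suppCard_add_le (Hypercube.slice f 0) (Hypercube.slice f 1)
      rw [pow_succ] at hl
      obtain ⟨ι, _, p, hι, hp⟩ := ih hf.slice_add (by rw [pow_succ]; omega)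
      classical
      obtain ⟨s, hs⟩ := exists_isBlockForm_cons hp
        (disjoint_of_suppCard_add (by omega)) (by rw [hι]; exact hf.slice 0) h0 h1
      exact ⟨ι, _, _, hι, hs⟩

end Hypercube

namespace Hypercube

open Finset

/-! ### Fourier coefficients -/

/-- The (unnormalized) Fourier coefficient of `f` at the character `chi S`. -/
noncomputable def fourier {n : ℕ} (S : Finset (Fin n)) : (Vertex n → ℝ) →ₗ[ℝ] ℝ where
  toFun f := ∑ x, f x * chi S x
  map_add' f g := by simp [add_mul, sum_add_distrib]
  map_smul' c f := by simp [mul_sum, mul_assoc]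

theorem fourier_apply {n : ℕ} (S : Finset (Fin n)) (f : Vertex n → ℝ) :
    fourier S f = ∑ x, f x * chi S x := rfl

theorem eq_zero_of_fourier {n : ℕ} {f : Vertex n → ℝ} (h : ∀ S, fourier S f = 0) : f = 0 := by
  rw [eq_sum_chi f]
  refine sum_eq_zero fun S _ => ?_
  rw [← fourier_apply, h, zero_smul, smul_zero]

/-- Eigenvectors of the symmetric adjacency matrix for distinct eigenvalues are orthogonal. -/
theorem fourier_eq_zero_of_mem_U {n k : ℕ} {f : Vertex n → ℝ} (hf : f ∈ U n k)
    {S : Finset (Fin n)} (hS : S.card ≠ k) : fourier S f = 0 := by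
  have h1 := Module.End.mem_eigenspace_iff.1 hf
  have h2 := Module.End.mem_eigenspace_iff.1 (chi_mem_U S)
  rw [adjOp, Matrix.toLin'_apply] at h1 h2
  have h3 : ((graph n).adjMatrix ℝ).mulVec f ⬝ᵥ chi S =
      f ⬝ᵥ ((graph n).adjMatrix ℝ).mulVec (chi S) := by
    rw [Matrix.dotProduct_mulVec, ← Matrix.mulVec_transpose, SimpleGraph.transpose_adjMatrix]
  rw [h1, h2, smul_dotProduct, dotProduct_smul, smul_eq_mul, smul_eq_mul] at h3
  have h4 : ((S.card : ℝ) - k) * (f ⬝ᵥ chi S) = 0 := by linear_combination h3 / 2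
  exact (mul_eq_zero.1 h4).resolve_left (sub_ne_zero.2 (Nat.cast_injective.ne hS))

theorem mem_UInterval_iff {n i j : ℕ} {f : Vertex n → ℝ} :
    f ∈ UInterval n i j ↔ ∀ S, fourier S f ≠ 0 → i ≤ S.card ∧ S.card ≤ j := by
  constructor
  · intro hf S hS
    by_contra h
    have hle : UInterval n i j ≤ LinearMap.ker (fourier S) :=
      iSup₂_le fun k hk g hg => fourier_eq_zero_of_mem_U hg fun hSk => by
        rw [mem_Icc] at hk
        omega
    exact hS (hle hf)
  · intro h
    rw [eq_sum_chi f]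
    refine Submodule.sum_mem _ fun S _ => Submodule.smul_mem _ _ ?_
    rw [← fourier_apply]
    by_cases hS : fourier S f = 0
    · rw [hS, zero_smul]
      exact Submodule.zero_mem _
    · exact Submodule.smul_mem _ _
        (Submodule.mem_iSup_of_mem S.card (Submodule.mem_iSup_of_mem (mem_Icc.2 (h S hS))
          (chi_mem_U S)))

theorem mem_Spec_iff {n m : ℕ} {f : Vertex n → ℝ} :
    m ∈ Spec f ↔ ∃ S : Finset (Fin n), S.card = m ∧ fourier S f ≠ 0 := by
  have hspec := (existsUnique_decomposition f).choose_spec.1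
  change (∀ i : Fin (n + 1), component f i ∈ U n i) ∧ f = ∑ i, component f i at hspec
  have hS : ∀ (S : Finset (Fin n)) (h : S.card < n + 1),
      fourier S f = fourier S (component f ⟨S.card, h⟩) := fun S h => by
    conv_lhs => rw [hspec.2, map_sum]
    refine sum_eq_single _ (fun i _ hi => fourier_eq_zero_of_mem_U (hspec.1 i) ?_) (by simp)
    rintro e
    exact hi (Fin.ext e.symm)
  constructor
  · rintro ⟨hm, hne⟩
    by_contra! h
    refine hne (eq_zero_of_fourier fun S => ?_)
    by_cases hSm : S.card = m
    · subst hSm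
      rw [← hS, h S rfl]
    · exact fourier_eq_zero_of_mem_U (hspec.1 _) hSm
  · rintro ⟨S, rfl, hne⟩
    have hlt : S.card < n + 1 := Nat.lt_succ_of_le (by simpa using S.card_le_univ)
    refine ⟨hlt, fun h => hne ?_⟩
    rw [hS S hlt, h, map_zero]

/-- The indicator of the subcube fixing `K` is a combination of the characters of subsets of `K`, by
expanding `∏ k ∈ K, (1 + sgn (a k) * sgn (x k))`. -/
theorem vanishesBelow_of_fourier {n r : ℕ} {f : Vertex n → ℝ}
    (h : ∀ S : Finset (Fin n), S.card < r → fourier S f = 0) : VanishesBelow r f := by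
  intro K hK a
  have h1 : ∀ x : Vertex n, (if ∀ k ∈ K, x k = a k then f x else 0) =
      (2 ^ K.card : ℝ)⁻¹ * ∑ S ∈ K.powerset, chi S a * (f x * chi S x) := by
    intro x
    have h2 : ∑ S ∈ K.powerset, chi S a * (f x * chi S x) =
        f x * ∏ k ∈ K, (1 + sgn (a k) * sgn (x k)) := by
      rw [prod_one_add, mul_sum]
      refine sum_congr rfl fun S _ => ?_
      rw [prod_mul_distrib]
      simp only [chi]
      ring
    rw [h2]
    simp only [one_add_sgn_mul]
    split_ifs with hx
    · rw [prod_congr rfl fun k hk => if_pos (hx k hk).symm, prod_const]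
      field_simp
    · push Not at hx
      obtain ⟨k, hk, hne⟩ := hx
      rw [prod_eq_zero hk (if_neg hne.symm)]
      simp
  simp only [h1]
  rw [← mul_sum, sum_comm]
  simp only [← mul_sum, ← fourier_apply]
  rw [sum_eq_zero, mul_zero]
  intro S hS
  rw [h S (lt_of_le_of_lt (card_le_card (mem_powerset.1 hS)) hK), mul_zero]

/-! ### Spectra of functions in block form -/

/-- Over the flat the sum factorises into one factor per block: a block meeting `T` in `m` points
contributes `1 + (-1) ^ (m + 1)`, which is 2 or 0. -/
theorem IsBlockForm.fourier_ne_zero_iff {n : ℕ} {ι : Type} [Fintype ι] [DecidableEq ι]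
    {p : Fin n → Option ι} {f : Vertex n → ℝ} (h : IsBlockForm p f) (T : Finset (Fin n)) :
    fourier T f ≠ 0 ↔ ∀ s, Odd #{t ∈ T | p t = some s} := by
  obtain ⟨hp, a, c, hc, hv, hs⟩ := h
  have h1 : ∀ z, chi T (blockEmb p a z) =
      chi T a * ∏ s, sgn (z s) ^ #{t ∈ T | p t = some s} := by
    intro z
    have h2 : ∀ t, sgn ((p t).elim 0 z) = ∏ s, if p t = some s then sgn (z s) else 1 := by
      intro t
      rcases p t with - | u
      · simp [sgn]
      · simp
    simp only [chi, blockEmb, sgn_add, prod_mul_distrib, h2]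
    rw [prod_comm]
    congr 1
    refine prod_congr rfl fun s _ => ?_
    rw [prod_ite, prod_const, prod_const_one, mul_one]
  have h3 : fourier T f = c * chi T a * ∏ s, (1 + (-1) ^ (#{t ∈ T | p t = some s} + 1)) := by
    have h4 : ∀ s, (1 + (-1 : ℝ) ^ (#{t ∈ T | p t = some s} + 1)) =
        ∑ b : ZMod 2, sgn b ^ (#{t ∈ T | p t = some s} + 1) := fun s => by
      rw [sum_zmod_two]
      simp [sgn]
    simp only [h4]
    rw [prod_univ_sum, Fintype.piFinset_univ, mul_sum, fourier_apply]
    symm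
    refine Fintype.sum_of_injective (blockEmb p a) (blockEmb_injective hp a) _ _ ?_ ?_
    · intro x hx
      rw [not_ne_iff.1 fun h => hx (hs x h), zero_mul]
    · intro z
      rw [hv, h1]
      simp only [pow_succ, prod_mul_distrib]
      ring
  have h5 : chi T a ≠ 0 := prod_ne_zero_iff.2 fun _ _ => sgn_ne_zero _
  rw [h3, mul_ne_zero_iff, and_iff_right (mul_ne_zero hc h5), prod_ne_zero_iff]
  simp only [mem_univ, true_imp_iff]
  refine forall_congr' fun s => ?_
  rcases Nat.even_or_odd #{t ∈ T | p t = some s} with he | ho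
  · rw [he.add_one.neg_one_pow]
    simp [he]
  · rw [ho.add_one.neg_one_pow]
    norm_num [ho]

theorem IsBlockForm.suppCard_eq {n : ℕ} {ι : Type} [Fintype ι] {p : Fin n → Option ι}
    {f : Vertex n → ℝ} (h : IsBlockForm p f) : suppCard f = 2 ^ Fintype.card ι := by
  classical
  obtain ⟨hp, a, c, hc, hv, hs⟩ := h
  have h1 : Function.support f = blockEmb p a '' Set.univ := by
    ext x
    simp only [Set.image_univ, Set.mem_range]
    refine ⟨hs x, ?_⟩
    rintro ⟨z, rfl⟩
    rw [Function.mem_support, hv]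
    exact mul_ne_zero hc (prod_ne_zero_iff.2 fun _ _ => sgn_ne_zero _)
  rw [suppCard, h1, Set.ncard_image_of_injective _ (blockEmb_injective hp a), Set.ncard_univ,
    Nat.card_eq_fintype_card]
  simp

theorem exists_isBlockForm {n : ℕ} {ι : Type} [Fintype ι] {p : Fin n → Option ι}
    (hp : ∀ s, ∃ t, p t = some s) : ∃ f : Vertex n → ℝ, IsBlockForm p f := by
  classical
  refine ⟨fun x => ∑ z, if blockEmb p 0 z = x then ∏ s, sgn (z s) else 0, hp, 0, 1, one_ne_zero,
    fun z => ?_, fun x hx => ?_⟩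
  · simp [(blockEmb_injective hp 0).eq_iff]
  · obtain ⟨z, _, hz⟩ := exists_ne_zero_of_sum_ne_zero hx
    exact ⟨z, (ite_ne_right_iff.1 hz).1⟩

/-- Descending from the maximum in steps of `d` stays in `A` until `r` is reached, and every element
of `A` descends to `r` in the same way. -/
theorem exists_eq_progression {A : Set ℕ} {r d : ℕ} (hd : 0 < d) (hne : A.Nonempty)
    (hbdd : BddAbove A) (hA : ∀ s ∈ A, s = r ∨ ∃ s' ∈ A, s = s' + d) :
    ∃ k, A = {s | ∃ t, t ≤ k ∧ s = r + t * d} := by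
  have h1 : ∀ s, s ∈ A → ∃ t, s = r + t * d := by
    intro s
    induction s using Nat.strong_induction_on with
    | _ s ih =>
      intro hs
      rcases hA s hs with rfl | ⟨s', hs', rfl⟩
      · exact ⟨0, by simp⟩
      · obtain ⟨t, rfl⟩ := ih s' (by omega) hs'
        exact ⟨t + 1, by ring⟩
  obtain ⟨k, hk⟩ := h1 _ (Nat.sSup_mem hne hbdd)
  have h2 : ∀ u ≤ k, r + (k - u) * d ∈ A := by
    intro u hu
    induction u with
    | zero =>
      rw [Nat.sub_zero, ← hk]
      exact Nat.sSup_mem hne hbdd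
    | succ u ih =>
      have e : r + (k - u) * d = r + (k - (u + 1)) * d + d := by
        rw [show k - u = k - (u + 1) + 1 by omega]
        ring
      rcases hA _ (ih (by omega)) with h | ⟨s', hs', h⟩
      · omega
      · rwa [show r + (k - (u + 1)) * d = s' by omega]
  refine ⟨k, Set.ext fun s => ⟨fun hs => ?_, ?_⟩⟩
  · obtain ⟨t, rfl⟩ := h1 s hs
    have := le_csSup hbdd hs
    rw [hk] at this
    exact ⟨t, Nat.le_of_mul_le_mul_right (Nat.le_of_add_le_add_left this) hd, rfl⟩
  · rintro ⟨t, ht, rfl⟩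
    have := h2 (k - t) (by omega)
    rwa [show k - (k - t) = t by omega] at this

theorem sum_card_block_add {n : ℕ} {ι : Type} [Fintype ι] [DecidableEq ι] (p : Fin n → Option ι)
    (T : Finset (Fin n)) :
    #T = #{t ∈ T | p t = none} + ∑ s, #{t ∈ T | p t = some s} := by
  rw [card_eq_sum_card_fiberwise (f := p) (t := univ) (by simp), Fintype.sum_option]

/-- If a set with odd intersections with all blocks is not a transversal, then a free element or
two elements of a block can be removed. -/
theorem exists_remove {n : ℕ} {ι : Type} [Fintype ι] [DecidableEq ι] {p : Fin n → Option ι}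
    {T : Finset (Fin n)} (hT : ∀ s, Odd #{t ∈ T | p t = some s}) (hr : #T ≠ Fintype.card ι) :
    (∃ e ∈ T, p e = none) ∨
      ∃ T' ⊆ T, (∀ s, Odd #{t ∈ T' | p t = some s}) ∧ #T = #T' + 2 := by
  by_contra! h
  obtain ⟨h1, h2⟩ := h
  apply hr
  rw [sum_card_block_add p, filter_eq_empty_iff.2 fun e he => h1 e he, card_empty, zero_add,
    Fintype.card_eq_sum_ones]
  refine sum_congr rfl fun s _ => ?_
  by_contra hs
  have hodd := hT s
  -- An odd count other than 1 is at least 3, so two points can be removed with the parity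
  -- preserved.
  have h3 : 1 < #{t ∈ T | p t = some s} := by
    have := hodd.pos
    omega
  obtain ⟨u, hu, v, hv, huv⟩ := one_lt_card.1 h3
  have huT := (mem_filter.1 hu).1
  have hvT := (mem_filter.1 hv).1
  have hpair : ({u, v} : Finset (Fin n)) ⊆ {t ∈ T | p t = some s} := by
    simp [insert_subset_iff, hu, hv]
  have hpairT : ({u, v} : Finset (Fin n)) ⊆ T := hpair.trans (filter_subset _ _)
  refine h2 (T \ {u, v}) sdiff_subset (fun s' => ?_) ?_
  · by_cases hss : s' = s
    · subst hss
      have e : ({t ∈ T \ {u, v} | p t = some s'} : Finset (Fin n)) =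
          {t ∈ T | p t = some s'} \ {u, v} := by
        ext t
        simp only [mem_filter, mem_sdiff]
        tauto
      rw [e, card_sdiff_of_subset hpair, card_pair huv]
      exact Nat.Odd.sub_even h3 hodd even_two
    · have e : ({t ∈ T \ {u, v} | p t = some s'} : Finset (Fin n)) = {t ∈ T | p t = some s'} := by
        ext t
        simp only [mem_filter, mem_sdiff, mem_insert, mem_singleton, not_or]
        refine ⟨fun h => ⟨h.1.1, h.2⟩, fun h => ⟨⟨h.1, ?_, ?_⟩, h.2⟩⟩
        · rintro rfl
          exact hss (Option.some_injective _ (h.2.symm.trans (mem_filter.1 hu).2))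
        · rintro rfl
          exact hss (Option.some_injective _ (h.2.symm.trans (mem_filter.1 hv).2))
      rw [e]
      exact hT s'
  · have h4 := card_le_card hpairT
    rw [card_sdiff_of_subset hpairT]
    rw [card_pair huv] at h4 ⊢
    omega

theorem IsBlockForm.ne_zero {n : ℕ} {ι : Type} [Fintype ι] {p : Fin n → Option ι}
    {f : Vertex n → ℝ} (h : IsBlockForm p f) : f ≠ 0 := fun h0 => by
  have := h.suppCard_eq
  rw [suppCard_eq_zero.2 h0] at this
  exact absurd this (by positivity)

/-- Every admissible `T` that is not of minimum size can be shrunk: by 1 if some coordinate `e` is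
fixed, by 2 otherwise. -/
theorem IsBlockForm.exists_spec_eq {n : ℕ} {ι : Type} [Fintype ι] {p : Fin n → Option ι}
    {f : Vertex n → ℝ} (h : IsBlockForm p f) :
    ∃ d k : ℕ, (d = 1 ∨ d = 2) ∧
      Spec f = {s | ∃ t : ℕ, t ≤ k ∧ s = Fintype.card ι + t * d} := by
  classical
  have hmem : ∀ m, m ∈ Spec f ↔
      ∃ T : Finset (Fin n), #T = m ∧ ∀ s, Odd #{t ∈ T | p t = some s} := fun m => by
    simp only [mem_Spec_iff, h.fourier_ne_zero_iff]
  have hne : (Spec f).Nonempty := by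
    by_contra hempty
    refine h.ne_zero (eq_zero_of_fourier fun S => ?_)
    by_contra hS
    exact hempty ⟨_, mem_Spec_iff.2 ⟨S, rfl, hS⟩⟩
  have hbdd : BddAbove (Spec f) := ⟨n, fun m hm => Nat.le_of_lt_succ hm.choose⟩
  by_cases he : ∃ e, p e = none
  · obtain ⟨e, he⟩ := he
    obtain ⟨k, hk⟩ := exists_eq_progression (r := Fintype.card ι) one_pos hne hbdd (by
      intro m hm
      obtain ⟨T, rfl, hT⟩ := (hmem m).1 hm
      by_cases hr : #T = Fintype.card ι
      · exact Or.inl hr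
      right
      by_cases hT1 : ∃ e ∈ T, p e = none
      · obtain ⟨u, hu, hpu⟩ := hT1
        refine ⟨#(T.erase u), (hmem _).2 ⟨_, rfl, fun s => ?_⟩, (card_erase_add_one hu).symm⟩
        rw [filter_erase, erase_eq_of_notMem (by simp [hpu])]
        exact hT s
      -- Removing a pair and inserting the fixed coordinate `e`, which `T` does not contain, lowers
      -- the size by exactly 1.
      · obtain ⟨T', hsub, hT', hcard⟩ := (exists_remove hT hr).resolve_left hT1
        have heT : e ∉ T' := fun h => hT1 ⟨e, hsub h, he⟩
        refine ⟨#(insert e T'), (hmem _).2 ⟨_, rfl, fun s => ?_⟩, ?_⟩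
        · rw [filter_insert, if_neg (by simp [he])]
          exact hT' s
        · rw [card_insert_of_notMem heT]
          exact hcard)
    exact ⟨1, k, Or.inl rfl, hk⟩
  · obtain ⟨k, hk⟩ := exists_eq_progression (r := Fintype.card ι) two_pos hne hbdd (by
      intro m hm
      obtain ⟨T, rfl, hT⟩ := (hmem m).1 hm
      by_cases hr : #T = Fintype.card ι
      · exact Or.inl hr
      obtain ⟨T', -, hT', hcard⟩ := (exists_remove hT hr).resolve_left
        fun ⟨e, _, h⟩ => he ⟨e, h⟩
      exact Or.inr ⟨#T', (hmem _).2 ⟨T', rfl, hT'⟩, hcard⟩)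
    exact ⟨2, k, Or.inr rfl, hk⟩

end Hypercube

namespace Hypercube

open Finset

/-! ### Functions of minimum support -/

theorem vanishesBelow_of_mem_UInterval {n i j : ℕ} {f : Vertex n → ℝ}
    (hf : f ∈ UInterval n i j) : VanishesBelow i f :=
  vanishesBelow_of_fourier fun S hS => by
    by_contra h
    have := mem_UInterval_iff.1 hf S h
    omega

theorem exists_spec_eq_of_suppCard_eq {n i j : ℕ} {f : Vertex n → ℝ}
    (hf : f ∈ UInterval n i j) (hcard : suppCard f = 2 ^ i) :
    ∃ d k : ℕ, (d = 1 ∨ d = 2) ∧ i + k * d ≤ j ∧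
      Spec f = {s | ∃ t : ℕ, t ≤ k ∧ s = i + t * d} := by
  obtain ⟨ι, _, p, rfl, hp⟩ := (vanishesBelow_of_mem_UInterval hf).exists_isBlockForm hcard
  obtain ⟨d, k, hd, hspec⟩ := hp.exists_spec_eq
  refine ⟨d, k, hd, ?_, hspec⟩
  have hk : Fintype.card ι + k * d ∈ Spec f := by
    rw [hspec]
    exact ⟨k, le_rfl, rfl⟩
  obtain ⟨S, hS, hne⟩ := mem_Spec_iff.1 hk
  rw [← hS]
  exact (mem_UInterval_iff.1 hf S hne).2

/-- The witness has `n - j` blocks of size two (possible since `n - j ≤ i`) and singletons for the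
remaining blocks. A set with odd intersections contains a point of each block and omits a point of
each pair, so its size lies between `i` and `j`. -/
theorem exists_suppCard_eq {n i j : ℕ} (hij : i ≤ j) (hjn : j ≤ n) (h : n ≤ i + j) :
    ∃ f ∈ UInterval n i j, f ≠ 0 ∧ suppCard f = 2 ^ i := by
  set p : Fin n → Option (Fin i) := fun t =>
    if h1 : (t : ℕ) < i then some ⟨t, h1⟩
    else if h2 : (t : ℕ) - i < n - j then some ⟨t - i, by omega⟩ else none with hp
  have hp1 : ∀ s : Fin i, p ⟨s, by omega⟩ = some s := fun s => by simp [hp]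
  have hp2 : ∀ s : Fin i, ∀ hs : (s : ℕ) < n - j, p ⟨i + s, by omega⟩ = some s := fun s hs => by
    simp [hp, hs]
  obtain ⟨f, hf⟩ := exists_isBlockForm (p := p) fun s => ⟨_, hp1 s⟩
  refine ⟨f, mem_UInterval_iff.2 fun T hT => ?_, hf.ne_zero, by simpa using hf.suppCard_eq⟩
  rw [hf.fourier_ne_zero_iff] at hT
  constructor
  · have h1 : ∑ _s : Fin i, 1 ≤ ∑ s, #{t ∈ T | p t = some s} :=
      sum_le_sum fun s _ => (hT s).pos
    rw [sum_card_block_add p]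
    simp only [sum_const, card_univ, Fintype.card_fin, smul_eq_mul, mul_one] at h1
    omega
  · have hmiss : ∀ s : Fin (n - j), ∃ t, t ∉ T ∧ p t = some ⟨s, by omega⟩ := by
      intro s
      by_contra! hall
      set s' : Fin i := ⟨s, by omega⟩ with hs'
      have e : ({t ∈ T | p t = some s'} : Finset (Fin n)) =
          {⟨s', by omega⟩, ⟨i + s', by have := s.2; simp [hs']; omega⟩} := by
        ext t
        simp only [mem_filter, mem_insert, mem_singleton]
        constructor
        · rintro ⟨_, ht⟩
          simp only [hp] at ht
          split_ifs at ht with h1 h2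
          · left
            have h3 := congrArg Fin.val (Option.some_injective _ ht)
            exact Fin.ext h3
          · right
            have h3 := congrArg Fin.val (Option.some_injective _ ht)
            ext
            simp only at h3 ⊢
            omega
        · have hpt : t = ⟨s', by omega⟩ ∨ t = ⟨i + s', by have := s.2; simp [hs']; omega⟩ →
              p t = some s' := by
            rintro (rfl | rfl)
            · exact hp1 s'
            · exact hp2 s' s.2
          exact fun ht => ⟨not_not.1 fun hnt => hall t hnt (hpt ht), hpt ht⟩
      have h2 := hT s'
      rw [e, card_pair (by
        intro h3
        have := congrArg Fin.val h3
        have := s'.2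
        simp at *
        omega)] at h2
      exact absurd h2 (by decide)
    choose g hgT hgp using hmiss
    have hinj : Function.Injective g := fun s s' hs => by
      have := (hgp s).symm.trans ((congrArg p hs).trans (hgp s'))
      simpa [Fin.ext_iff] using this
    have h1 : #(univ.image g) ≤ #Tᶜ :=
      card_le_card fun t ht => by
        obtain ⟨s, _, rfl⟩ := mem_image.1 ht
        simpa using hgT s
    rw [card_image_of_injective _ hinj, card_compl] at h1
    have h2 := card_le_univ T
    simp only [card_univ, Fintype.card_fin] at h1 h2
    omega

/-! ### Duality -/

theorem chi_ne_zero {n : ℕ} (S : Finset (Fin n)) (x : Vertex n) : chi S x ≠ 0 :=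
  prod_ne_zero_iff.2 fun _ _ => sgn_ne_zero _

theorem suppCard_mul_chi {n : ℕ} (f : Vertex n → ℝ) (S : Finset (Fin n)) :
    suppCard (f * chi S) = suppCard f := by
  rw [suppCard, suppCard]
  congr 1
  ext x
  simp [chi_ne_zero]

theorem fourier_mul_chi_univ {n : ℕ} (f : Vertex n → ℝ) (S : Finset (Fin n)) :
    fourier S (f * chi univ) = fourier Sᶜ f := by
  rw [fourier_apply, fourier_apply]
  refine sum_congr rfl fun x _ => ?_
  have h : chi S x * chi S x = 1 := by
    rw [chi, ← prod_mul_distrib]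
    exact prod_eq_one fun k _ => sgn_mul_self _
  have h2 : chi univ x = chi S x * chi Sᶜ x := (prod_mul_prod_compl S _).symm
  rw [Pi.mul_apply, h2]
  linear_combination f x * chi Sᶜ x * h

theorem mul_chi_univ_mem {n i j : ℕ} {f : Vertex n → ℝ} (hf : f ∈ UInterval n i j) :
    f * chi univ ∈ UInterval n (n - j) (n - i) := by
  rw [mem_UInterval_iff] at hf ⊢
  intro S hS
  rw [fourier_mul_chi_univ] at hS
  have h1 := hf _ hS
  have h2 := card_le_univ S
  rw [card_compl] at h1
  rw [Fintype.card_fin] at h1 h2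
  omega

/-- The dual function `f * chi univ` has lower endpoint `n - j`, and complementation turns `n - j +
t * d` into `j - t * d`. -/
theorem exists_spec_eq_of_suppCard_eq' {n i j : ℕ} (hij : i ≤ j) (hjn : j ≤ n) {f : Vertex n → ℝ}
    (hf : f ∈ UInterval n i j) (hcard : suppCard f = 2 ^ (n - j)) :
    ∃ d k : ℕ, (d = 1 ∨ d = 2) ∧ i + k * d ≤ j ∧
      Spec f = {s | ∃ t : ℕ, t ≤ k ∧ s + t * d = j} := by
  obtain ⟨d, k, hd, hle, hspec⟩ := exists_spec_eq_of_suppCard_eq (mul_chi_univ_mem hf)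
    ((suppCard_mul_chi f univ).trans hcard)
  refine ⟨d, k, hd, by omega, Set.ext fun s => ?_⟩
  have hS : ∀ S : Finset (Fin n), #Sᶜ + #S = n := fun S => by
    simp
  rw [mem_Spec_iff]
  constructor
  · rintro ⟨S, rfl, hne⟩
    have h1 : #Sᶜ ∈ Spec (f * chi univ) :=
      mem_Spec_iff.2 ⟨Sᶜ, rfl, by rwa [fourier_mul_chi_univ, compl_compl]⟩
    rw [hspec] at h1
    obtain ⟨t, ht, h2⟩ := h1
    have := hS S
    exact ⟨t, ht, by omega⟩
  · rintro ⟨t, ht, rfl⟩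
    have h1 : n - (s + t * d) + t * d ∈ Spec (f * chi univ) := by
      rw [hspec]
      exact ⟨t, ht, rfl⟩
    obtain ⟨S, h2, hne⟩ := mem_Spec_iff.1 h1
    rw [fourier_mul_chi_univ] at hne
    have := hS S
    exact ⟨Sᶜ, by omega, hne⟩

/-! ### Support size of optimal functions and the final theorem -/

theorem IsOptimal.suppCard_eq {n i j : ℕ} {f : Vertex n → ℝ} (hf : IsOptimal i j f)
    (hij : i ≤ j) (hjn : j ≤ n) (h : n ≤ i + j) : suppCard f = 2 ^ i := by
  obtain ⟨g, hg, hg0, hgc⟩ := exists_suppCard_eq hij hjn h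
  exact le_antisymm (hgc ▸ hf.2.2 g hg hg0)
    ((vanishesBelow_of_mem_UInterval hf.1).two_pow_le hf.2.1)

theorem IsOptimal.suppCard_eq' {n i j : ℕ} {f : Vertex n → ℝ} (hf : IsOptimal i j f)
    (hij : i ≤ j) (hjn : j ≤ n) (h : i + j ≤ n) : suppCard f = 2 ^ (n - j) := by
  have hne : ∀ g : Vertex n → ℝ, g ≠ 0 → g * chi univ ≠ 0 := fun g hg h0 => hg <| by
    rw [← suppCard_eq_zero, ← suppCard_mul_chi g univ, suppCard_eq_zero, h0]
  refine (suppCard_mul_chi f univ).symm.trans (IsOptimal.suppCard_eq (j := n - i)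
    ⟨mul_chi_univ_mem hf.1, hne f hf.2.1, fun g hg hg0 => ?_⟩ (by omega) (by omega) (by omega))
  -- A competitor of the dual function is carried back to the original interval by the same
  -- multiplication.
  have h1 := mul_chi_univ_mem hg
  rw [Nat.sub_sub_self (hij.trans hjn), Nat.sub_sub_self hjn] at h1
  have h2 := hf.2.2 _ h1 (hne g hg0)
  rwa [suppCard_mul_chi] at h2 ⊢

end Hypercube

theorem mainTheorem3 (n i j : ℕ) (hij : i ≤ j) (hjn : j ≤ n) :
    (∀ f : Hypercube.Vertex n → ℝ, Hypercube.IsOptimal i j f →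
      ∃ a d k : ℕ, (d = 1 ∨ d = 2) ∧
        Hypercube.Spec f = {s | ∃ t : ℕ, t ≤ k ∧ s = a + t * d}) ∧
    (n ≤ i + j → ∀ f ∈ Hypercube.UInterval n i j, Hypercube.suppCard f = 2 ^ i →
      ∃ d k : ℕ, (d = 1 ∨ d = 2) ∧ i + k * d ≤ j ∧
        Hypercube.Spec f = {s | ∃ t : ℕ, t ≤ k ∧ s = i + t * d}) ∧
    (i + j ≤ n → ∀ f ∈ Hypercube.UInterval n i j, Hypercube.suppCard f = 2 ^ (n - j) →
      ∃ d k : ℕ, (d = 1 ∨ d = 2) ∧ i + k * d ≤ j ∧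
        Hypercube.Spec f = {s | ∃ t : ℕ, t ≤ k ∧ s + t * d = j}) := by
  refine ⟨fun f hf => ?_, fun _ f hf hc => Hypercube.exists_spec_eq_of_suppCard_eq hf hc,
    fun _ f hf hc => Hypercube.exists_spec_eq_of_suppCard_eq' hij hjn hf hc⟩
  rcases le_total n (i + j) with h | h
  · obtain ⟨d, k, hd, -, hspec⟩ :=
      Hypercube.exists_spec_eq_of_suppCard_eq hf.1 (hf.suppCard_eq hij hjn h)
    exact ⟨i, d, k, hd, hspec⟩
  · obtain ⟨d, k, hd, hle, hspec⟩ :=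
      Hypercube.exists_spec_eq_of_suppCard_eq' hij hjn hf.1 (hf.suppCard_eq' hij hjn h)
    -- The subtraction is not truncated because `i + k * d ≤ j`. The progression is then reversed by
    -- `t ↦ k - t`.
    refine ⟨j - k * d, d, k, hd, hspec.trans (Set.ext fun s => ⟨?_, ?_⟩)⟩
    · rintro ⟨t, ht, hs⟩
      refine ⟨k - t, Nat.sub_le _ _, ?_⟩
      have := Nat.mul_le_mul_right d ht
      rw [Nat.sub_mul]
      omega
    · rintro ⟨t, ht, rfl⟩
      refine ⟨k - t, Nat.sub_le _ _, ?_⟩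
      have := Nat.mul_le_mul_right d ht
      rw [Nat.sub_mul]
      omega
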